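/- **Model.** An $n$-node network is a finite simple graph $G=(V,E)$, $|V|=n$, whose nodes carry distinct identifiers chosen arbitrarily (natural numbers). Computation is synchronous and deterministic; in each round every node may send an arbitrary message of unbounded size to each neighbour, and local computation is free (LOCAL model). A node initially knows only its own identifier and those of its neighbours; in particular it does not know $n$. An arbitrary set $\mathrm{Byz}\subseteq V$ of nodes is Byzantine: in every round these nodes send arbitrary messages, possibly different ones to different neighbours, chosen with full knowledge of the system, but a receiver always knows the true identifier of the neighbour that sent a message. The other nodes are good. A node may irrevocably decide on a natural number. The vertex expansion of $G$ is $h(G)=\min_{0<|S|\le n/2}|\mathrm{Out}(S)|/|S|$, where $\mathrm{Out}(S)$ is the set of neighbours of $S$ in $V\setminus S$. **Theorem.** Let $\gamma\in(0,1)$, an integer $\Delta>0$ and $\alpha>0$ be arbitrary fixed constants. There are a deterministic LOCAL algorithm, a constant $C$ and a function $f(n)=o(n)$, depending only on $\gamma,\Delta,\alpha$, such that the following holds. Let $G$ be any $n$-node network with maximum degree at most $\Delta$ and vertex expansion $h(G)\ge\alpha$, and let $\mathrm{Byz}\subseteq V$ be any set of at most $n^{1-\gamma}$ Byzantine nodes.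 Then there is a set $\mathrm{Good}\subseteq V\setminus\mathrm{Byz}$ of at least $n-f(n)$ good nodes such that, for every assignment of distinct identifiers and every behaviour of the Byzantine nodes, each $u\in\mathrm{Good}$ decides within $C\log n$ rounds on a value $L_u$ with $$\frac{\gamma}{2\log\Delta}\,\log n\;\le\;L_u\;\le\;C\log n\qquad\text{and}\qquad\Big\lfloor\frac{\gamma}{2}\log_\Delta n\Big\rfloor\;\le\;L_u\;\le\;\mathrm{diam}(G)+1 .$$ -/

import Mathlib

open Filter Asymptotics

/-- `Out(S)`: the vertices outside `S` that have a neighbour in `S`. -/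
def SimpleGraph.outNeighbors {V : Type} [Fintype V] [DecidableEq V]
    (G : SimpleGraph V) [DecidableRel G.Adj] (S : Finset V) : Finset V :=
  S.biUnion (fun v => G.neighborFinset v) \ S

/-- The vertex expansion `h(G) = min |Out(S)| / |S|` over all `S` with `0 < |S| ≤ n / 2`.
(On a graph with at least two vertices this is a minimum over a finite nonempty family; on fewer
vertices there is no such `S` and the value is `0` by convention.) -/
noncomputable def SimpleGraph.vertexExpansion {V : Type} [Fintype V] [DecidableEq V]
    (G : SimpleGraph V) [DecidableRel G.Adj] : ℝ :=
  ⨅ S : {S : Finset V // 0 < S.card ∧ 2 * S.card ≤ Fintype.card V},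
    ((G.outNeighbors S.1).card : ℝ) / (S.1.card : ℝ)

/-- A deterministic algorithm in the synchronous LOCAL model. Node identifiers are natural numbers,
messages are elements of an arbitrary type (no bound on their size), and local computation is free
(arbitrary functions). Initially a node knows its own identifier and those of its neighbours, and
nothing else about the network. In every round it sends to each neighbour a message or stays silent
(`none`), and then updates its state from the messages received, each of which carries the true
identifier of the neighbour that sent it. `output s = some L` says that a node in state `s` has
decided on the value `L`; a decision is never revoked. -/
structure LocalAlgorithm where
  State : Type
  Msg : Type
  /-- initial state, from the node's own identifier and the set of its neighbours' identifiers -/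
  init : ℕ → Finset ℕ → State
  /-- the message sent to the neighbour with the given identifier -/
  send : State → ℕ → Option Msg
  /-- the new state, from the old one and the messages received, indexed by sender identifier -/
  step : State → (ℕ → Option Msg) → State
  output : State → Option ℕ
  irrevocable : ∀ (s : State) (inbox : ℕ → Option Msg) (L : ℕ),
    output s = some L → output (step s inbox) = some L

namespace LocalAlgorithm

open Classical in
/-- What node `u` receives when `msg v w` is the message that `v` sends to `w`: for the identifier
of a neighbour `v` of `u`, the message from `v` to `u`; nothing for other identifiers. -/
noncomputable def inbox {V M : Type} (G : SimpleGraph V) (ident : V → ℕ)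
    (msg : V → V → Option M) (u : V) (i : ℕ) : Option M :=
  if h : ∃ v, G.Adj u v ∧ ident v = i then msg h.choose u else none

open Classical in
/-- The state of every honest node after `t` rounds on the network `G` with identifiers `ident` and
Byzantine nodes `Byz`, where `adv t v w` is the message that a Byzantine node `v` sends to its
neighbour `w` in round `t + 1`. As honest nodes are deterministic, letting `adv` range over all
functions covers every adaptive omniscient adversary with unbounded computational power.
(The states attached to the Byzantine nodes themselves are never used.) -/
noncomputable def stateAt {V : Type} [Fintype V] (A : LocalAlgorithm) (G : SimpleGraph V)
    (ident : V → ℕ) (Byz : Finset V) (adv : ℕ → V → V → Option A.Msg) : ℕ → V → A.State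
  | 0 => fun u => A.init (ident u) ((G.neighborFinset u).image ident)
  | t + 1 => fun u =>
      A.step (A.stateAt G ident Byz adv t u)
        (inbox G ident
          (fun v w => if v ∈ Byz then adv t v w
            else A.send (A.stateAt G ident Byz adv t v) (ident w)) u)

end LocalAlgorithm

/-! Nodes flood everything they hear. A node then asks which sizes `m` are consistent with its view:
is there an expander on `m` vertices, with some Byzantine set, in which the node is reliable,
meaning that a lazy random walk from it avoids that set for `escapeTime α Δ m` = O(log m) steps with
probability above 3/4? Local computation is free, so this search is allowed.

The crux is that consistent sizes agree up to a factor 2 (`Explains.le_two_mul`). Suppose networks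
of sizes `n` and `m > 2n` both explain a view. Two walks coupled through the identifiers coincide
while both avoid the Byzantine vertices, so with probability above 3/4 + 3/4 - 1 = 1/2 the walk in
the large network sees only identifiers of the small one (`survival_add_survival_le`). These occupy
at most `n < m/2` vertices, and a Dirichlet Cheeger inequality makes the walk leave such a set by
time `escapeTime α Δ n` with probability at least 1/2 (`Expands.survival_sq_le`), a contradiction.

The uniform measure is invariant under the walk, so all but O(log n) · |Byz| vertices are reliable,
and this set depends on neither identifiers nor adversary. Since the true network always explains
the view of a reliable node, such a node decides in O(log n) rounds, on a size within a factor 2 of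
the truth. -/

namespace SimpleGraph

/-! ### Edge sums, and the diameter under a degree bound. -/

variable {V : Type} [Fintype V] (G : SimpleGraph V) [DecidableRel G.Adj]

theorem sum_neighborFinset_comm (F : V → V → ℝ) :
    ∑ x, ∑ y ∈ G.neighborFinset x, F x y = ∑ x, ∑ y ∈ G.neighborFinset x, F y x := by
  simp only [neighborFinset_eq_filter, Finset.sum_filter]
  rw [Finset.sum_comm]
  simp only [G.adj_comm]

theorem sum_neighborFinset_const_le {Δ : ℕ} (hdeg : ∀ v, G.degree v ≤ Δ) {w : V → ℝ}
    (hw : ∀ v, 0 ≤ w v) :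
    ∑ x, ∑ _y ∈ G.neighborFinset x, w x ≤ Δ * ∑ x, w x := by
  rw [Finset.mul_sum]
  refine Finset.sum_le_sum fun x _ => ?_
  rw [Finset.sum_const, nsmul_eq_mul, card_neighborFinset_eq_degree]
  exact mul_le_mul_of_nonneg_right (by exact_mod_cast hdeg x) (hw x)

variable {G}

/-- A ball gains at most a factor Δ + 1 per unit of radius, and the ball of radius `G.diam` is
everything. -/
theorem card_le_pow_diam (hG : G.Connected) {Δ : ℕ} (hdeg : ∀ v, G.degree v ≤ Δ) :
    Fintype.card V ≤ (Δ + 1) ^ G.diam := by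
  classical
  have := hG.nonempty
  let u : V := Classical.arbitrary V
  have hball : ∀ r : ℕ, (Finset.univ.filter fun v => G.dist u v ≤ r).card ≤ (Δ + 1) ^ r := by
    intro r
    induction r with
    | zero =>
      rw [pow_zero, Finset.card_le_one]
      intro a ha b hb
      simp only [Finset.mem_filter, Finset.mem_univ, true_and, Nat.le_zero,
        hG.dist_eq_zero_iff] at ha hb
      rw [← ha, ← hb]
    | succ r ih =>
      have hsub : (Finset.univ.filter fun v => G.dist u v ≤ r + 1) ⊆
          (Finset.univ.filter fun v => G.dist u v ≤ r).biUnion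
            fun v => insert v (G.neighborFinset v) := by
        intro v hv
        simp only [Finset.mem_filter, Finset.mem_univ, true_and] at hv
        simp only [Finset.mem_biUnion, Finset.mem_filter, Finset.mem_univ, true_and,
          Finset.mem_insert, mem_neighborFinset]
        by_cases hle : G.dist u v ≤ r
        · exact ⟨v, hle, Or.inl rfl⟩
        · obtain ⟨p, hp⟩ := hG.exists_walk_length_eq_dist v u
          cases p with
          | nil => simp at hle
          | cons hadj q =>
            rename_i w
            refine ⟨w, ?_, Or.inr hadj.symm⟩
            have h1 := dist_le q
            rw [Walk.length_cons] at hp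
            rw [dist_comm] at h1
            rw [dist_comm] at hv
            omega
      refine (Finset.card_le_card hsub).trans ((Finset.card_biUnion_le_card_mul _ _ (Δ + 1)
        fun v _ => (Finset.card_insert_le _ _).trans ?_).trans ?_)
      · rw [card_neighborFinset_eq_degree]
        exact Nat.succ_le_succ (hdeg v)
      · rw [pow_succ]
        exact Nat.mul_le_mul_right _ ih
  have huniv : (Finset.univ.filter fun v => G.dist u v ≤ G.diam) = Finset.univ := by
    refine Finset.filter_true_of_mem fun v _ => dist_le_diam ?_
    exact connected_iff_ediam_ne_top.1 hG
  simpa [huniv] using hball G.diam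

/-! ### The lazy random walk. -/

/-- One step of the lazy random walk with transition matrix `1 - L / (2 Δ)`, where `L` is the
Laplacian, applied to a function. -/
noncomputable def lazyStep (G : SimpleGraph V) [DecidableRel G.Adj] (Δ : ℕ) (f : V → ℝ) (u : V) :
    ℝ :=
  f u + 1 / (2 * Δ) * ∑ v ∈ G.neighborFinset u, (f v - f u)

theorem lazyStep_mono {Δ : ℕ} (hΔ : 0 < Δ) {f g : V → ℝ} {u : V} (hu : G.degree u ≤ Δ)
    (h0 : f u ≤ g u) (h : ∀ v, G.Adj u v → f v ≤ g v) :
    G.lazyStep Δ f u ≤ G.lazyStep Δ g u := by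
  have hΔ' : (0 : ℝ) < Δ := by exact_mod_cast hΔ
  have hd : (G.degree u : ℝ) ≤ Δ := by exact_mod_cast hu
  have hsum : ∑ v ∈ G.neighborFinset u, f v ≤ ∑ v ∈ G.neighborFinset u, g v :=
    Finset.sum_le_sum fun v hv => h v ((G.mem_neighborFinset u v).1 hv)
  have hrw : ∀ k : V → ℝ, G.lazyStep Δ k u =
      (1 - G.degree u / (2 * Δ)) * k u + 1 / (2 * Δ) * ∑ v ∈ G.neighborFinset u, k v := by
    intro k
    rw [lazyStep, Finset.sum_sub_distrib, Finset.sum_const, nsmul_eq_mul,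
      card_neighborFinset_eq_degree]
    ring
  rw [hrw, hrw]
  refine add_le_add (mul_le_mul_of_nonneg_left h0 ?_)
    (mul_le_mul_of_nonneg_left hsum (by positivity))
  rw [sub_nonneg, div_le_one (by positivity)]
  linarith

theorem lazyStep_const (Δ : ℕ) (c : ℝ) (u : V) : G.lazyStep Δ (fun _ => c) u = c := by
  simp [lazyStep]

/-- The transition matrix is symmetric, so the uniform measure is invariant: the two orientations of
an edge cancel. -/
theorem sum_lazyStep (Δ : ℕ) (f : V → ℝ) : ∑ u, G.lazyStep Δ f u = ∑ u, f u := by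
  have h := sum_neighborFinset_comm G fun x y => f y - f x
  have h' : ∑ x, ∑ y ∈ G.neighborFinset x, (f x - f y) =
      - ∑ x, ∑ y ∈ G.neighborFinset x, (f y - f x) := by
    rw [← Finset.sum_neg_distrib]
    refine Finset.sum_congr rfl fun x _ => ?_
    rw [← Finset.sum_neg_distrib]
    exact Finset.sum_congr rfl fun y _ => by ring
  simp only [lazyStep, Finset.sum_add_distrib, ← Finset.mul_sum]
  rw [show ∑ x, ∑ y ∈ G.neighborFinset x, (f y - f x) = 0 by linarith]
  ring

/-- Expanding the square, the cross term contributes -1/(2Δ) times the Dirichlet energy. By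
Cauchy–Schwarz the quadratic term costs at most 1/(4Δ) times it; laziness is what leaves a net loss.
-/
theorem sum_sq_lazyStep_le {Δ : ℕ} (hΔ : 0 < Δ) (hdeg : ∀ v, G.degree v ≤ Δ) (f : V → ℝ) :
    ∑ u, G.lazyStep Δ f u ^ 2 ≤
      ∑ u, f u ^ 2 - 1 / (4 * Δ) * ∑ x, ∑ y ∈ G.neighborFinset x, (f y - f x) ^ 2 := by
  have hΔ' : (0 : ℝ) < Δ := by exact_mod_cast hΔ
  have hpt : ∀ u, G.lazyStep Δ f u ^ 2 ≤ f u ^ 2 +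
      1 / Δ * (∑ v ∈ G.neighborFinset u, f u * (f v - f u)) +
      1 / (4 * Δ) * ∑ v ∈ G.neighborFinset u, (f v - f u) ^ 2 := by
    intro u
    have hcs := sq_sum_le_card_mul_sum_sq (s := G.neighborFinset u) (f := fun v => f v - f u)
    rw [card_neighborFinset_eq_degree] at hcs
    have hd : (G.degree u : ℝ) ≤ Δ := by exact_mod_cast hdeg u
    have hnn : 0 ≤ ∑ v ∈ G.neighborFinset u, (f v - f u) ^ 2 :=
      Finset.sum_nonneg fun _ _ => sq_nonneg _
    have hcs' := hcs.trans (mul_le_mul_of_nonneg_right hd hnn)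
    rw [lazyStep, ← Finset.mul_sum]
    set s := ∑ v ∈ G.neighborFinset u, (f v - f u)
    set q := ∑ v ∈ G.neighborFinset u, (f v - f u) ^ 2
    have : 1 / (4 * (Δ : ℝ) ^ 2) * s ^ 2 ≤ 1 / (4 * Δ) * q := by
      calc 1 / (4 * (Δ : ℝ) ^ 2) * s ^ 2 ≤ 1 / (4 * (Δ : ℝ) ^ 2) * (Δ * q) :=
            mul_le_mul_of_nonneg_left hcs' (by positivity)
        _ = 1 / (4 * Δ) * q := by field_simp
    calc (f u + 1 / (2 * Δ) * s) ^ 2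
        = f u ^ 2 + 1 / Δ * (f u * s) + 1 / (4 * (Δ : ℝ) ^ 2) * s ^ 2 := by field_simp; ring
      _ ≤ _ := by linarith
  -- Summing over both orientations of each edge turns the cross term into an energy.
  have hsym : 2 * ∑ x, ∑ y ∈ G.neighborFinset x, f x * (f y - f x) =
      - ∑ x, ∑ y ∈ G.neighborFinset x, (f y - f x) ^ 2 := by
    have h := sum_neighborFinset_comm G fun x y => f x * (f y - f x)
    rw [two_mul]
    nth_rewrite 2 [h]
    rw [← Finset.sum_add_distrib, ← Finset.sum_neg_distrib]
    refine Finset.sum_congr rfl fun x _ => ?_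
    rw [← Finset.sum_add_distrib, ← Finset.sum_neg_distrib]
    exact Finset.sum_congr rfl fun y _ => by ring
  refine (Finset.sum_le_sum fun u _ => hpt u).trans_eq ?_
  rw [Finset.sum_add_distrib, Finset.sum_add_distrib, ← Finset.mul_sum, ← Finset.mul_sum]
  rw [show ∑ x, ∑ y ∈ G.neighborFinset x, f x * (f y - f x) =
    -(1 / 2) * ∑ x, ∑ y ∈ G.neighborFinset x, (f y - f x) ^ 2 by linarith]
  field_simp
  ring

/-! ### Vertex expansion and the Dirichlet Cheeger inequality. -/

variable [DecidableEq V]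

/-- Every set of at most half of the vertices has at least `α` times as many outer neighbours. -/
def Expands (G : SimpleGraph V) [DecidableRel G.Adj] (α : ℝ) : Prop :=
  ∀ S : Finset V, 0 < S.card → 2 * S.card ≤ Fintype.card V →
    α * S.card ≤ (G.outNeighbors S).card

theorem expands_of_le_vertexExpansion {α : ℝ} (h : α ≤ G.vertexExpansion) : G.Expands α := by
  intro S h0 h2
  have hb : BddBelow (Set.range fun S : {S : Finset V // 0 < S.card ∧ 2 * S.card ≤ Fintype.card V} =>
      ((G.outNeighbors S.1).card : ℝ) / (S.1.card : ℝ)) :=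
    ⟨0, by rintro _ ⟨S, rfl⟩; positivity⟩
  have := h.trans (ciInf_le hb ⟨S, h0, h2⟩)
  rwa [le_div_iff₀ (by exact_mod_cast h0)] at this

theorem mem_outNeighbors {S : Finset V} {v : V} :
    v ∈ G.outNeighbors S ↔ (∃ u ∈ S, G.Adj u v) ∧ v ∉ S := by
  simp [outNeighbors]

/-- Needed for the diameter bound, since `diam` of a disconnected graph is the default value 0. A
component or its complement would be a set of at most half the vertices with no outer neighbour. -/
theorem Expands.connected {α : ℝ} (hα : 0 < α) (h : G.Expands α) [Nonempty V] :
    G.Connected := by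
  classical
  have key : ∀ S : Finset V, S.Nonempty → 2 * S.card ≤ Fintype.card V →
      (∀ u ∈ S, ∀ v, G.Adj u v → v ∈ S) → False := by
    intro S hne h2 hcl
    have hS : G.outNeighbors S = ∅ := by
      ext v
      simp only [mem_outNeighbors, Finset.notMem_empty, iff_false, not_and, not_not]
      rintro ⟨u, hu, huv⟩
      exact hcl u hu v huv
    have := h S hne.card_pos h2
    rw [hS] at this
    rw [Finset.card_empty, Nat.cast_zero] at this
    have h0 : (0 : ℝ) < S.card := by exact_mod_cast hne.card_pos
    exact absurd this (not_le.2 (mul_pos hα h0))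
  refine (connected_iff_exists_forall_reachable G).2 ?_
  obtain ⟨u⟩ := ‹Nonempty V›
  refine ⟨u, fun w => ?_⟩
  by_contra hw
  set S : Finset V := Finset.univ.filter fun v => G.Reachable u v with hSdef
  have hcl : ∀ x y, G.Adj x y → (x ∈ S ↔ y ∈ S) := by
    intro x y hxy
    simp only [hSdef, Finset.mem_filter, Finset.mem_univ, true_and]
    exact ⟨fun hx => hx.trans hxy.reachable, fun hy => hy.trans hxy.symm.reachable⟩
  have hc := Finset.card_add_card_compl S
  rcases le_total (2 * S.card) (Fintype.card V) with h2 | h2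
  · exact key S ⟨u, by simp [hSdef]⟩ h2 fun x hx y hxy => (hcl x y hxy).1 hx
  · refine key Sᶜ ⟨w, by simpa [hSdef] using hw⟩ (by omega) fun x hx y hxy => ?_
    rw [Finset.mem_compl] at hx ⊢
    exact fun hy => hx ((hcl x y hxy).2 hy)

/-- A co-area inequality: the total increase of a nonnegative function along the edges of an
expander, for functions supported on at most half of the vertices. -/
theorem Expands.coarea {α : ℝ} (h : G.Expands α) (g : V → ℝ) (hg : ∀ v, 0 ≤ g v)
    (hs : 2 * (Finset.univ.filter fun v => g v ≠ 0).card ≤ Fintype.card V) :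
    α * ∑ v, g v ≤ ∑ y, ∑ x ∈ G.neighborFinset y, max (g x - g y) 0 := by
  induction hk : (Finset.univ.filter fun v => g v ≠ 0).card using Nat.strong_induction_on
    generalizing g with
  | _ k ih =>
    set U := Finset.univ.filter fun v => g v ≠ 0 with hU
    have hmemU : ∀ v, v ∈ U ↔ g v ≠ 0 := by simp [hU]
    rcases U.eq_empty_or_nonempty with hemp | hne
    · have h0 : ∀ v, g v = 0 := by
        intro v
        by_contra hv
        exact Finset.notMem_empty v (hemp ▸ (hmemU v).2 hv)
      simp [h0]
    -- Peel off the lowest layer: subtracting the least positive value `m` on the support `U`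
    -- shrinks the support, and each outer neighbour of `U` accounts for an increase of at least `m`
    -- along some edge.
    · obtain ⟨v₀, hv₀, hmin⟩ := Finset.exists_min_image U g hne
      set m := g v₀ with hm
      have hm0 : 0 < m := lt_of_le_of_ne (hg v₀) ((hmemU v₀).1 hv₀).symm
      let g' : V → ℝ := fun v => if v ∈ U then g v - m else 0
      have hg' : ∀ v, 0 ≤ g' v := by
        intro v
        simp only [g']
        split_ifs with hv
        · linarith [hmin v hv]
        · exact le_rfl
      have hsub : (Finset.univ.filter fun v => g' v ≠ 0) ⊂ U := by
        refine (Finset.ssubset_iff_of_subset ?_).2 ⟨v₀, hv₀, ?_⟩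
        · intro v hv
          by_contra hvU
          simp [g', hvU] at hv
        · simp [g', hv₀, hm]
      have hcard := Finset.card_lt_card hsub
      have hrec := ih _ (hk ▸ hcard) g' hg' (by omega) rfl
      have hsum : ∑ v, g v = ∑ v, g' v + m * U.card := by
        have : ∀ v, g v = g' v + if v ∈ U then m else 0 := by
          intro v
          by_cases hv : v ∈ U
          · simp [g', hv]
          · simpa [g', hv] using hv ∘ (hmemU v).2
        rw [Finset.sum_congr rfl fun v _ => this v, Finset.sum_add_distrib]
        congr 1
        rw [Finset.sum_ite_mem, Finset.univ_inter, Finset.sum_const, nsmul_eq_mul, mul_comm]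
      have hinc : ∑ y, ∑ x ∈ G.neighborFinset y, max (g' x - g' y) 0 +
          m * (G.outNeighbors U).card ≤
          ∑ y, ∑ x ∈ G.neighborFinset y, max (g x - g y) 0 := by
        have hcardout : m * (G.outNeighbors U).card =
            ∑ y, if y ∈ G.outNeighbors U then m else 0 := by
          rw [Finset.sum_ite_mem, Finset.univ_inter, Finset.sum_const, nsmul_eq_mul, mul_comm]
        rw [hcardout, ← Finset.sum_add_distrib]
        refine Finset.sum_le_sum fun y _ => ?_
        have hpt : ∀ x, max (g' x - g' y) 0 + (if x ∈ U ∧ y ∉ U then m else 0) ≤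
            max (g x - g y) 0 := by
          intro x
          by_cases hx : x ∈ U <;> by_cases hy : y ∈ U
          · simp [g', hx, hy]
          · have hy0 : g y = 0 := by simpa using hy ∘ (hmemU y).2
            have := hmin x hx
            simp only [g', hx, hy, hy0, if_true, if_false, not_false_eq_true, and_self, sub_zero]
            rw [max_eq_left (by linarith), max_eq_left (by linarith)]
            linarith
          · have hx0 : g x = 0 := by simpa using hx ∘ (hmemU x).2
            have := hmin y hy
            simp only [g', hx, hy, hx0, if_true, if_false, false_and, add_zero]
            rw [max_eq_right (by linarith)]
            exact le_max_right _ _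
          · have hy0 : g y = 0 := by simpa using hy ∘ (hmemU y).2
            have hx0 : g x = 0 := by simpa using hx ∘ (hmemU x).2
            simp [g', hx, hy, hx0, hy0]
        refine le_trans ?_ (Finset.sum_le_sum fun x _ => hpt x)
        rw [Finset.sum_add_distrib]
        refine add_le_add le_rfl ?_
        have hnn : ∀ x ∈ G.neighborFinset y, 0 ≤ (if x ∈ U ∧ y ∉ U then m else 0) := by
          intro x _
          split_ifs
          · exact hm0.le
          · exact le_rfl
        split_ifs with hy
        · obtain ⟨⟨x, hx, hxy⟩, hyU⟩ := mem_outNeighbors.1 hy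
          refine le_trans ?_ (Finset.single_le_sum hnn ((G.mem_neighborFinset y x).2 hxy.symm))
          rw [if_pos ⟨hx, hyU⟩]
        · exact Finset.sum_nonneg hnn
      have hexp := h U hne.card_pos hs
      rw [hsum, mul_add]
      nlinarith [mul_le_mul_of_nonneg_left hexp hm0.le]

/-- A Cheeger inequality with Dirichlet boundary conditions. -/
theorem Expands.sum_sq_le {α : ℝ} (hα : 0 < α) (h : G.Expands α) {Δ : ℕ} (hΔ : 0 < Δ)
    (hdeg : ∀ v, G.degree v ≤ Δ) (f : V → ℝ)
    (hs : 2 * (Finset.univ.filter fun v => f v ≠ 0).card ≤ Fintype.card V) :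
    α ^ 2 / (4 * Δ) * ∑ v, f v ^ 2 ≤ ∑ x, ∑ y ∈ G.neighborFinset x, (f y - f x) ^ 2 := by
  have hΔ' : (0 : ℝ) < Δ := by exact_mod_cast hΔ
  have hco := h.coarea (fun v => f v ^ 2) (fun v => sq_nonneg _) (by simpa using hs)
  set E := ∑ x, ∑ y ∈ G.neighborFinset x, (f y - f x) ^ 2
  set N := ∑ v, f v ^ 2
  have hpt : ∀ x y, max (f x ^ 2 - f y ^ 2) 0 ≤
      2 * Δ / α * (f x - f y) ^ 2 + α / (4 * Δ) * (f x ^ 2 + f y ^ 2) := by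
    intro x y
    have hpos : 0 < α / (4 * Δ) := by positivity
    have hr : 2 * Δ / α * (f x - f y) ^ 2 = 1 / 2 / (α / (4 * Δ)) * (f x - f y) ^ 2 := by
      field_simp
      ring
    rw [hr]
    -- Weighted AM–GM on (f x - f y)(f x + f y); this ε makes the second term sum to at most half of
    -- α ∑ f², which is then absorbed on the left.
    set ε := α / (4 * Δ)
    refine max_le ?_ (by positivity)
    have h1 : 0 ≤ 1 / 2 / ε * ((f x - f y) - ε * (f x + f y)) ^ 2 := by positivity
    have h2 : 1 / 2 / ε * ((f x - f y) - ε * (f x + f y)) ^ 2 =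
        1 / 2 / ε * (f x - f y) ^ 2 - (f x ^ 2 - f y ^ 2) + ε / 2 * (f x + f y) ^ 2 := by
      field_simp
      ring
    nlinarith [mul_nonneg hpos.le (sq_nonneg (f x - f y))]
  have hdegsum : ∑ y, ∑ x ∈ G.neighborFinset y, (f x ^ 2 + f y ^ 2) ≤ 2 * (Δ * N) := by
    have h1 := sum_neighborFinset_const_le G hdeg (w := fun v => f v ^ 2) fun v => sq_nonneg _
    have h2 := sum_neighborFinset_comm G fun x _ => f x ^ 2
    simp only [Finset.sum_add_distrib]
    rw [← h2]
    linarith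
  have hle : α * N ≤ 2 * Δ / α * E + α / (4 * Δ) * (2 * (Δ * N)) := by
    refine hco.trans ((Finset.sum_le_sum fun y _ => Finset.sum_le_sum fun x _ => hpt x y).trans ?_)
    simp only [Finset.sum_add_distrib, ← Finset.mul_sum] at hdegsum ⊢
    exact add_le_add le_rfl (mul_le_mul_of_nonneg_left hdegsum (by positivity))
  have h3 : α / (4 * Δ) * (2 * (Δ * N)) = α / 2 * N := by field_simp; ring
  rw [h3] at hle
  have h4 : α / 2 * N ≤ 2 * Δ / α * E := by linarith
  calc α ^ 2 / (4 * Δ) * N = α / (2 * Δ) * (α / 2 * N) := by field_simp; ring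
    _ ≤ α / (2 * Δ) * (2 * Δ / α * E) := mul_le_mul_of_nonneg_left h4 (by positivity)
    _ = E := by field_simp

/-! ### Survival probabilities. -/

/-- The probability that the lazy random walk started at a vertex stays in `A` for `t` steps. -/
noncomputable def survival (G : SimpleGraph V) [DecidableRel G.Adj] (Δ : ℕ) (A : Finset V) :
    ℕ → V → ℝ
  | 0, u => if u ∈ A then 1 else 0
  | t + 1, u => if u ∈ A then G.lazyStep Δ (survival G Δ A t) u else 0

theorem survival_of_notMem (Δ : ℕ) {A : Finset V} (t : ℕ) {u : V} (hu : u ∉ A) :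
    G.survival Δ A t u = 0 := by
  cases t <;> simp [survival, hu]

theorem survival_nonneg {Δ : ℕ} (hΔ : 0 < Δ) (hdeg : ∀ v, G.degree v ≤ Δ) (A : Finset V) (t : ℕ)
    (u : V) : 0 ≤ G.survival Δ A t u := by
  induction t generalizing u with
  | zero => rw [survival]; split_ifs <;> norm_num
  | succ t ih =>
    rw [survival]
    split_ifs
    · rw [← lazyStep_const (G := G) Δ 0 u]
      exact lazyStep_mono hΔ (hdeg u) (ih u) fun v _ => ih v
    · exact le_rfl

theorem survival_le_one {Δ : ℕ} (hΔ : 0 < Δ) (hdeg : ∀ v, G.degree v ≤ Δ) (A : Finset V) (t : ℕ)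
    (u : V) : G.survival Δ A t u ≤ 1 := by
  induction t generalizing u with
  | zero => rw [survival]; split_ifs <;> norm_num
  | succ t ih =>
    rw [survival]
    split_ifs
    · rw [← lazyStep_const (G := G) Δ 1 u]
      exact lazyStep_mono hΔ (hdeg u) (ih u) fun v _ => ih v
    · exact zero_le_one

theorem survival_antitone {Δ : ℕ} (hΔ : 0 < Δ) (hdeg : ∀ v, G.degree v ≤ Δ) (A : Finset V)
    (u : V) : Antitone fun t => G.survival Δ A t u := by
  refine antitone_nat_of_succ_le fun t => ?_
  induction t generalizing u with
  | zero =>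
    by_cases hu : u ∈ A
    · simpa [survival, hu] using survival_le_one hΔ hdeg A 1 u
    · simp [survival, hu]
  | succ t ih =>
    by_cases hu : u ∈ A
    · have h := lazyStep_mono hΔ (hdeg u) (ih u) fun v _ => ih v
      rw [survival, if_pos hu]
      conv_rhs => rw [survival, if_pos hu]
      exact h
    · simp [survival, hu]

/-- A union bound over the t + 1 times of the walk: from a uniform start, each visit to `B` has
probability |B|/|V| by invariance. -/
theorem sum_one_sub_survival_le {Δ : ℕ} (hΔ : 0 < Δ) (hdeg : ∀ v, G.degree v ≤ Δ) (B : Finset V)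
    (t : ℕ) : ∑ u, (1 - G.survival Δ Bᶜ t u) ≤ (t + 1) * B.card := by
  have hB : (B.card : ℝ) = ∑ u, if u ∈ B then (1 : ℝ) else 0 := by simp
  induction t with
  | zero =>
    rw [hB, Nat.cast_zero, zero_add, one_mul]
    refine Finset.sum_le_sum fun u _ => ?_
    by_cases hu : u ∈ B <;> simp [survival, hu]
  | succ t ih =>
    have hpt : ∀ u, 1 - G.survival Δ Bᶜ (t + 1) u ≤
        (if u ∈ B then 1 else 0) + (1 - G.lazyStep Δ (G.survival Δ Bᶜ t) u) := by
      intro u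
      by_cases hu : u ∈ B
      · have : G.lazyStep Δ (G.survival Δ Bᶜ t) u ≤ 1 := by
          rw [← lazyStep_const (G := G) Δ 1 u]
          exact lazyStep_mono hΔ (hdeg u) (survival_le_one hΔ hdeg _ _ _)
            fun v _ => survival_le_one hΔ hdeg _ _ _
        simpa [survival, hu] using this
      · simp [survival, hu]
    refine (Finset.sum_le_sum fun u _ => hpt u).trans ?_
    rw [Finset.sum_add_distrib, ← hB, Finset.sum_sub_distrib, sum_lazyStep,
      ← Finset.sum_sub_distrib]
    push_cast
    linarith

/-- The walk leaves a set of at most half of the vertices of an expander exponentially fast. -/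
theorem Expands.survival_sq_le {α : ℝ} (hα : 0 < α) (h : G.Expands α) {Δ : ℕ} (hΔ : 0 < Δ)
    (hdeg : ∀ v, G.degree v ≤ Δ) (A : Finset V) (hA : 2 * A.card ≤ Fintype.card V) (t : ℕ)
    (u : V) :
    G.survival Δ A t u ^ 2 ≤ Real.exp (-(α ^ 2 / (16 * Δ ^ 2) * t)) * A.card := by
  have hΔ' : (0 : ℝ) < Δ := by exact_mod_cast hΔ
  have hsum : ∑ v, G.survival Δ A t v ^ 2 ≤
      Real.exp (-(α ^ 2 / (16 * Δ ^ 2) * t)) * A.card := by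
    induction t with
    | zero => simp [survival]
    | succ t ih =>
      set f := G.survival Δ A t
      have hsupp : 2 * (Finset.univ.filter fun v => f v ≠ 0).card ≤ Fintype.card V := by
        refine le_trans (Nat.mul_le_mul_left _ (Finset.card_le_card fun v hv => ?_)) hA
        by_contra hvA
        exact (Finset.mem_filter.1 hv).2 (survival_of_notMem Δ t hvA)
      have h1 : ∑ v, G.survival Δ A (t + 1) v ^ 2 ≤ ∑ v, G.lazyStep Δ f v ^ 2 := by
        refine Finset.sum_le_sum fun v _ => ?_
        rw [survival]
        split_ifs
        · exact le_rfl
        · simpa using sq_nonneg _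
      have h2 := sum_sq_lazyStep_le hΔ hdeg f
      have h3 := h.sum_sq_le hα hΔ hdeg f hsupp
      have h4 : ∑ v, G.survival Δ A (t + 1) v ^ 2 ≤
          (1 - α ^ 2 / (16 * Δ ^ 2)) * ∑ v, f v ^ 2 := by
        have h5 := mul_le_mul_of_nonneg_left h3 (by positivity : (0 : ℝ) ≤ 1 / (4 * Δ))
        have h6 : 1 / (4 * (Δ : ℝ)) * (α ^ 2 / (4 * Δ) * ∑ v, f v ^ 2) =
            α ^ 2 / (16 * Δ ^ 2) * ∑ v, f v ^ 2 := by
          field_simp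
          ring
        rw [h6] at h5
        linarith
      have hN : 0 ≤ ∑ v, f v ^ 2 := Finset.sum_nonneg fun _ _ => sq_nonneg _
      have hexp := Real.add_one_le_exp (-(α ^ 2 / (16 * (Δ : ℝ) ^ 2)))
      calc ∑ v, G.survival Δ A (t + 1) v ^ 2
          ≤ (1 - α ^ 2 / (16 * Δ ^ 2)) * ∑ v, f v ^ 2 := h4
        _ ≤ Real.exp (-(α ^ 2 / (16 * Δ ^ 2))) * ∑ v, f v ^ 2 :=
            mul_le_mul_of_nonneg_right (by linarith) hN
        _ ≤ Real.exp (-(α ^ 2 / (16 * Δ ^ 2))) *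
              (Real.exp (-(α ^ 2 / (16 * Δ ^ 2) * t)) * A.card) :=
            mul_le_mul_of_nonneg_left ih (Real.exp_nonneg _)
        _ = Real.exp (-(α ^ 2 / (16 * Δ ^ 2) * (t + 1 : ℕ))) * A.card := by
            rw [← mul_assoc, ← Real.exp_add]
            congr 2
            push_cast
            ring
  -- A single value is bounded by the ℓ² norm; the resulting factor |A| costs only logarithmically
  -- many more steps.
  exact (Finset.single_le_sum (f := fun v => G.survival Δ A t v ^ 2)
    (fun _ _ => sq_nonneg _) (Finset.mem_univ u)).trans hsum

end SimpleGraph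

/-! ### Views, and the coupling of two walks that share a view. -/

namespace SimpleGraph

section Views

variable {V : Type} (G : SimpleGraph V) (Byz : Finset V) (ident : V → ℕ)

/-- A view assigns to every path of identifiers, read as a chain of hearsay, the claimed set of
neighbours of its last node. `Faithful t P u` says that the view `P` of `u` is right about all paths
of length at most `t` that avoid the Byzantine nodes. -/
def Faithful : ℕ → (List ℕ → Finset ℕ) → V → Prop
  | 0, P, u => ∀ i, i ∈ P [] ↔ ∃ v, G.Adj u v ∧ ident v = i
  | t + 1, P, u => (∀ i, i ∈ P [] ↔ ∃ v, G.Adj u v ∧ ident v = i) ∧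
      ∀ v, G.Adj u v → v ∉ Byz → Faithful t (fun p => P (ident v :: p)) v

variable {G Byz ident}

theorem Faithful.mem_nil_iff {t : ℕ} {P : List ℕ → Finset ℕ} {u : V}
    (h : G.Faithful Byz ident t P u) (i : ℕ) : i ∈ P [] ↔ ∃ v, G.Adj u v ∧ ident v = i := by
  cases t with
  | zero => exact h i
  | succ t => exact h.1 i

theorem Faithful.of_succ {t : ℕ} {P : List ℕ → Finset ℕ} {u : V}
    (h : G.Faithful Byz ident (t + 1) P u) : G.Faithful Byz ident t P u := by
  induction t generalizing P u with
  | zero => exact h.1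
  | succ t ih => exact ⟨h.1, fun v huv hv => ih (h.2 v huv hv)⟩

theorem Faithful.mono {s t : ℕ} (hst : s ≤ t) {P : List ℕ → Finset ℕ} {u : V}
    (h : G.Faithful Byz ident t P u) : G.Faithful Byz ident s P u := by
  induction hst with
  | refl => exact h
  | step _ ih => exact ih h.of_succ

end Views

/-- If two networks explain the same view, then in the second one the walk is likely to stay among
the identifiers of the first one. -/
theorem survival_add_survival_le {V₁ V₂ : Type} [Fintype V₁] [DecidableEq V₁] [Fintype V₂]
    [DecidableEq V₂] {G₁ : SimpleGraph V₁} {G₂ : SimpleGraph V₂} [DecidableRel G₁.Adj]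
    [DecidableRel G₂.Adj] {Δ : ℕ} (hΔ : 0 < Δ) (hdeg₁ : ∀ v, G₁.degree v ≤ Δ)
    (hdeg₂ : ∀ v, G₂.degree v ≤ Δ) {B₁ : Finset V₁} {B₂ : Finset V₂} {id₁ : V₁ → ℕ} {id₂ : V₂ → ℕ}
    (hid₁ : Function.Injective id₁) (hid₂ : Function.Injective id₂) {A : Finset V₂}
    (hA : ∀ v, v ∈ A ↔ ∃ w, id₁ w = id₂ v) {t : ℕ} {P : List ℕ → Finset ℕ} {u₁ : V₁} {u₂ : V₂}
    (hu : id₁ u₁ = id₂ u₂) (h₁ : G₁.Faithful B₁ id₁ t P u₁) (h₂ : G₂.Faithful B₂ id₂ t P u₂) :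
    G₁.survival Δ B₁ᶜ t u₁ + G₂.survival Δ B₂ᶜ t u₂ - 1 ≤ G₂.survival Δ A t u₂ := by
  induction t generalizing P u₁ u₂ with
  | zero =>
    have huA : u₂ ∈ A := (hA _).2 ⟨u₁, hu⟩
    have ha := survival_le_one hΔ hdeg₁ B₁ᶜ 0 u₁
    have hb := survival_le_one hΔ hdeg₂ B₂ᶜ 0 u₂
    have hc : G₂.survival Δ A 0 u₂ = 1 := by simp [survival, huA]
    linarith
  | succ t ih =>
    have hnn := survival_nonneg hΔ hdeg₂ A (t + 1) u₂
    -- On a Byzantine vertex of either network one survival probability vanishes, so the left side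
    -- is at most 0.
    by_cases hB₁ : u₁ ∈ B₁
    · rw [survival_of_notMem Δ _ (show u₁ ∉ B₁ᶜ by simpa using hB₁)]
      linarith [survival_le_one hΔ hdeg₂ B₂ᶜ (t + 1) u₂]
    by_cases hB₂ : u₂ ∈ B₂
    · rw [survival_of_notMem Δ _ (show u₂ ∉ B₂ᶜ by simpa using hB₂)]
      linarith [survival_le_one hΔ hdeg₁ B₁ᶜ (t + 1) u₁]
    have huA : u₂ ∈ A := (hA _).2 ⟨u₁, hu⟩
    have : Nonempty V₁ := ⟨u₁⟩
    -- Matches vertices with equal identifiers; values at unmatched vertices are arbitrary and never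
    -- used.
    let φ : V₂ → V₁ := fun v => Function.invFun id₁ (id₂ v)
    have hφ : ∀ {v w}, id₁ w = id₂ v → φ v = w := fun {v w} h => by
      simp only [φ, ← h, Function.leftInverse_invFun hid₁ w]
    have hφadj : ∀ v, G₂.Adj u₂ v → G₁.Adj u₁ (φ v) ∧ id₁ (φ v) = id₂ v := by
      intro v hv
      obtain ⟨w, hw, hwv⟩ := (h₁.mem_nil_iff _).1 ((h₂.mem_nil_iff (id₂ v)).2 ⟨v, hv, rfl⟩)
      rw [hφ hwv]
      exact ⟨hw, hwv⟩
    have hbij : ∀ g : V₁ → ℝ,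
        ∑ w ∈ G₁.neighborFinset u₁, g w = ∑ v ∈ G₂.neighborFinset u₂, g (φ v) := by
      intro g
      symm
      refine Finset.sum_bij (fun v _ => φ v) ?_ ?_ ?_ fun _ _ => rfl
      · intro v hv
        rw [mem_neighborFinset] at hv ⊢
        exact (hφadj v hv).1
      · intro a ha b hb hab
        rw [mem_neighborFinset] at ha hb
        exact hid₂ ((hφadj a ha).2 ▸ (hφadj b hb).2 ▸ congrArg id₁ hab)
      · intro w hw
        rw [mem_neighborFinset] at hw
        obtain ⟨v, hv, hvw⟩ := (h₂.mem_nil_iff _).1 ((h₁.mem_nil_iff (id₁ w)).2 ⟨w, hw, rfl⟩)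
        exact ⟨v, (mem_neighborFinset _ _ _).2 hv, hφ hvw.symm⟩
    -- The coupling bound as a function on the second network. Faithfulness makes `φ` a bijection
    -- between the two neighbourhoods, so one step of both walks is one step applied to `k`.
    let k : V₂ → ℝ := fun v => G₁.survival Δ B₁ᶜ t (φ v) + G₂.survival Δ B₂ᶜ t v - 1
    have hk : G₁.lazyStep Δ (G₁.survival Δ B₁ᶜ t) u₁ + G₂.lazyStep Δ (G₂.survival Δ B₂ᶜ t) u₂ - 1 =
        G₂.lazyStep Δ k u₂ := by
      have hs : ∑ v ∈ G₂.neighborFinset u₂, (k v - k u₂) =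
          ∑ v ∈ G₂.neighborFinset u₂, (G₁.survival Δ B₁ᶜ t (φ v) - G₁.survival Δ B₁ᶜ t u₁) +
          ∑ v ∈ G₂.neighborFinset u₂, (G₂.survival Δ B₂ᶜ t v - G₂.survival Δ B₂ᶜ t u₂) := by
        rw [← Finset.sum_add_distrib]
        refine Finset.sum_congr rfl fun v _ => ?_
        simp only [k, hφ hu]
        ring
      rw [lazyStep, lazyStep, lazyStep, hs, hbij]
      simp only [k, hφ hu]
      ring
    rw [survival, survival, survival, if_pos huA, if_pos (by simpa using hB₁),
      if_pos (by simpa using hB₂), hk]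
    refine lazyStep_mono hΔ (hdeg₂ u₂) ?_ fun v hv => ?_
    · simp only [k, hφ hu]
      exact ih hu h₁.of_succ h₂.of_succ
    · obtain ⟨hadj, hidv⟩ := hφadj v hv
      have hnnv := survival_nonneg hΔ hdeg₂ A t v
      by_cases hv₁ : φ v ∈ B₁
      · have h0 : G₁.survival Δ B₁ᶜ t (φ v) = 0 := survival_of_notMem Δ t (by simpa using hv₁)
        simp only [k, h0]
        linarith [survival_le_one hΔ hdeg₂ B₂ᶜ t v]
      by_cases hv₂ : v ∈ B₂
      · have h0 : G₂.survival Δ B₂ᶜ t v = 0 := survival_of_notMem Δ t (by simpa using hv₂)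
        simp only [k, h0]
        linarith [survival_le_one hΔ hdeg₁ B₁ᶜ t (φ v)]
      have hf₁ := h₁.2 (φ v) hadj hv₁
      rw [hidv] at hf₁
      exact ih hidv hf₁ (h₂.2 v hv hv₂)

/-! ### Escape times, reliable vertices and consistent sizes. -/

/-- The number of steps after which the walk has left a given set of `m` vertices of an expander with
probability at least `1 / 2`. -/
noncomputable def escapeTime (α : ℝ) (Δ m : ℕ) : ℕ :=
  ⌊16 * Δ ^ 2 / α ^ 2 * Real.log (4 * m)⌋₊ + 1

theorem escapeTime_mono (α : ℝ) (Δ : ℕ) {m n : ℕ} (hm : 0 < m) (hmn : m ≤ n) :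
    escapeTime α Δ m ≤ escapeTime α Δ n := by
  have hm' : (0 : ℝ) < m := by exact_mod_cast hm
  refine Nat.succ_le_succ (Nat.floor_le_floor ?_)
  gcongr

theorem exp_escapeTime_mul_le {α : ℝ} (hα : 0 < α) {Δ : ℕ} (hΔ : 0 < Δ) {m : ℕ} (hm : 0 < m) :
    Real.exp (-(α ^ 2 / (16 * Δ ^ 2) * escapeTime α Δ m)) * m ≤ 1 / 4 := by
  have hΔ' : (0 : ℝ) < Δ := by exact_mod_cast hΔ
  have hm' : (0 : ℝ) < m := by exact_mod_cast hm
  have h := (Nat.lt_floor_add_one (16 * Δ ^ 2 / α ^ 2 * Real.log (4 * m))).le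
  have h1 : Real.log (4 * m) ≤ α ^ 2 / (16 * Δ ^ 2) * escapeTime α Δ m := by
    rw [escapeTime]
    push_cast
    refine le_trans (le_of_eq ?_)
      (mul_le_mul_of_nonneg_left h (by positivity : (0 : ℝ) ≤ α ^ 2 / (16 * Δ ^ 2)))
    field_simp
  calc Real.exp (-(α ^ 2 / (16 * Δ ^ 2) * escapeTime α Δ m)) * m
      ≤ Real.exp (-Real.log (4 * m)) * m := by gcongr
    _ = 1 / 4 := by
      rw [Real.exp_neg, Real.exp_log (by positivity)]
      field_simp

open Classical in
/-- The vertices from which the lazy walk avoids the Byzantine vertices for the escape time of the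
whole network, with probability more than `3 / 4`. -/
noncomputable def reliable {V : Type} [Fintype V] [DecidableEq V] (G : SimpleGraph V)
    [DecidableRel G.Adj] (α : ℝ) (Δ : ℕ) (Byz : Finset V) : Finset V :=
  Finset.univ.filter fun u => 3 / 4 < G.survival Δ Byzᶜ (escapeTime α Δ (Fintype.card V)) u

theorem disjoint_reliable {V : Type} [Fintype V] [DecidableEq V] (G : SimpleGraph V)
    [DecidableRel G.Adj] (α : ℝ) (Δ : ℕ) (Byz : Finset V) :
    Disjoint (G.reliable α Δ Byz) Byz := by
  rw [Finset.disjoint_left]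
  intro u hu hB
  rw [reliable, Finset.mem_filter, survival_of_notMem Δ _ (by simpa using hB)] at hu
  norm_num at hu

/-- Markov's inequality: an unreliable vertex contributes at least 1/4 to the sum in
`sum_one_sub_survival_le`. -/
theorem le_card_reliable {V : Type} [Fintype V] [DecidableEq V] {G : SimpleGraph V}
    [DecidableRel G.Adj] (α : ℝ) {Δ : ℕ} (hΔ : 0 < Δ) (hdeg : ∀ v, G.degree v ≤ Δ)
    (Byz : Finset V) :
    (Fintype.card V : ℝ) - 4 * ((escapeTime α Δ (Fintype.card V) + 1) * Byz.card) ≤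
      (G.reliable α Δ Byz).card := by
  classical
  set T := escapeTime α Δ (Fintype.card V)
  have h := sum_one_sub_survival_le hΔ hdeg Byz T
  have hpt : ∀ u, (if u ∈ (G.reliable α Δ Byz)ᶜ then (1 / 4 : ℝ) else 0) ≤
      1 - G.survival Δ Byzᶜ T u := by
    intro u
    split_ifs with hu
    · simp only [reliable, Finset.mem_compl, Finset.mem_filter, Finset.mem_univ, true_and,
        not_lt] at hu
      linarith
    · linarith [survival_le_one hΔ hdeg Byzᶜ T u]
  have h' := (Finset.sum_le_sum fun u (_ : u ∈ Finset.univ) => hpt u).trans h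
  rw [Finset.sum_ite_mem, Finset.univ_inter, Finset.sum_const, nsmul_eq_mul] at h'
  have hc : ((G.reliable α Δ Byz).card : ℝ) + ((G.reliable α Δ Byz)ᶜ.card : ℝ) =
      Fintype.card V := by exact_mod_cast Finset.card_add_card_compl _
  linarith

/-- The view `P` at time `t` of a node with identifier `i` can be the one of a reliable node of some
`m`-node expander. -/
def Explains (α : ℝ) (Δ m t i : ℕ) (P : List ℕ → Finset ℕ) : Prop :=
  ∃ (V : Type) (_ : Fintype V) (_ : DecidableEq V) (G : SimpleGraph V) (_ : DecidableRel G.Adj)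
    (Byz : Finset V) (ident : V → ℕ) (u : V),
    Fintype.card V = m ∧ (∀ v, G.degree v ≤ Δ) ∧ G.Expands α ∧ Function.Injective ident ∧
    u ∈ G.reliable α Δ Byz ∧ ident u = i ∧ G.Faithful Byz ident t P u

theorem Explains.le_two_mul {α : ℝ} (hα : 0 < α) {Δ : ℕ} (hΔ : 0 < Δ) {m n t i : ℕ}
    {P : List ℕ → Finset ℕ} (hm : Explains α Δ m t i P) (hn : Explains α Δ n t i P)
    (ht : escapeTime α Δ n ≤ t) : m ≤ 2 * n := by
  by_contra! hlt
  obtain ⟨V₂, _, _, G₂, _, B₂, id₂, u₂, hc₂, hdeg₂, hexp₂, hid₂, hu₂, hi₂, hf₂⟩ := hm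
  obtain ⟨V₁, _, _, G₁, _, B₁, id₁, u₁, hc₁, hdeg₁, -, hid₁, hu₁, hi₁, hf₁⟩ := hn
  classical
  set T := escapeTime α Δ n
  have hn0 : 0 < n := hc₁ ▸ Fintype.card_pos_iff.2 ⟨u₁⟩
  have hT : T ≤ escapeTime α Δ m := escapeTime_mono α Δ hn0 (by omega)
  let A : Finset V₂ := Finset.univ.filter fun v => ∃ w, id₁ w = id₂ v
  have hA : ∀ v, v ∈ A ↔ ∃ w, id₁ w = id₂ v := by simp [A]
  have hAcard : A.card ≤ n := by
    rw [← hc₁, ← Finset.card_univ, ← Finset.card_image_of_injective _ hid₁,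
      ← Finset.card_image_of_injective A hid₂]
    refine Finset.card_le_card fun j hj => ?_
    obtain ⟨v, hv, rfl⟩ := Finset.mem_image.1 hj
    obtain ⟨w, hw⟩ := (hA v).1 hv
    exact Finset.mem_image.2 ⟨w, Finset.mem_univ w, hw⟩
  have hsum := survival_add_survival_le hΔ hdeg₁ hdeg₂ hid₁ hid₂ hA (hi₁.trans hi₂.symm)
    (hf₁.mono ht) (hf₂.mono ht)
  have h₁ : 3 / 4 < G₁.survival Δ B₁ᶜ T u₁ := by
    simpa [reliable, hc₁] using hu₁
  have h₂ : 3 / 4 < G₂.survival Δ B₂ᶜ T u₂ := by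
    have h : 3 / 4 < G₂.survival Δ B₂ᶜ (escapeTime α Δ m) u₂ := by
      simpa [reliable, hc₂] using hu₂
    -- Reliability in the larger network concerns its own, longer escape time; survival only
    -- improves at the shorter time `T`.
    exact h.trans_le (survival_antitone hΔ hdeg₂ B₂ᶜ u₂ hT)
  have hsq := hexp₂.survival_sq_le hα hΔ hdeg₂ A (by omega) T u₂
  have hlast : G₂.survival Δ A T u₂ ^ 2 ≤ 1 / 4 :=
    (hsq.trans (mul_le_mul_of_nonneg_left (by exact_mod_cast hAcard) (Real.exp_nonneg _))).trans
      (exp_escapeTime_mul_le hα hΔ hn0)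
  -- The coupling gives survival strictly above 1/2, while its square is at most 1/4.
  nlinarith

end SimpleGraph

open SimpleGraph

/-! ### The counting algorithm and its correctness. -/

namespace LocalAlgorithm

/-- The value decided by a node that believes in a network of `m` nodes. -/
noncomputable def diamEstimate (γ : ℝ) (Δ m : ℕ) : ℕ :=
  ⌈γ / 2 * Real.logb Δ (2 * m)⌉₊

/-- The state of a node in the counting algorithm. -/
structure CountingState where
  self : ℕ
  time : ℕ
  view : List ℕ → Finset ℕ
  decision : Option ℕ

/-- The view of a node after it has received the views of its neighbours. -/
def updateView (P : List ℕ → Finset ℕ) (inbox : ℕ → Option (List ℕ → Finset ℕ)) :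
    List ℕ → Finset ℕ
  | [] => P []
  | i :: p => (inbox i).elim ∅ fun Q => Q p

open Classical in
/-- The decision rule: as soon as some size whose escape time has passed explains the view, decide
according to that size. -/
noncomputable def decideSize (γ α : ℝ) (Δ t i : ℕ) (P : List ℕ → Finset ℕ) : Option ℕ :=
  if h : ∃ m, escapeTime α Δ m ≤ t ∧ Explains α Δ m t i P then some (diamEstimate γ Δ h.choose) else none

/-- Every node repeatedly sends its whole view to its neighbours and decides by `decideSize`. -/
noncomputable def counting (γ α : ℝ) (Δ : ℕ) : LocalAlgorithm where
  State := CountingState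
  Msg := List ℕ → Finset ℕ
  init i N := ⟨i, 0, fun _ => N, none⟩
  send s _ := some s.view
  step s inbox := ⟨s.self, s.time + 1, updateView s.view inbox,
    s.decision.or (decideSize γ α Δ (s.time + 1) s.self (updateView s.view inbox))⟩
  output s := s.decision
  irrevocable s inbox L h := by simp [h]

theorem inbox_ident {V M : Type} {G : SimpleGraph V} {ident : V → ℕ}
    (hid : Function.Injective ident) (msg : V → V → Option M) {u v : V} (huv : G.Adj u v) :
    inbox G ident msg u (ident v) = msg v u := by
  have h : ∃ w, G.Adj u w ∧ ident w = ident v := ⟨v, huv, rfl⟩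
  rw [inbox, dif_pos h, hid h.choose_spec.2]

section Counting

variable {V : Type} [Fintype V] (γ α : ℝ) (Δ : ℕ) (G : SimpleGraph V) (ident : V → ℕ)
  (Byz : Finset V) (adv : ℕ → V → V → Option (counting γ α Δ).Msg)

theorem counting_time (t : ℕ) (u : V) :
    ((counting γ α Δ).stateAt G ident Byz adv t u).time = t := by
  induction t with
  | zero => rfl
  | succ t ih => exact congrArg (· + 1) ih

theorem counting_self (t : ℕ) (u : V) :
    ((counting γ α Δ).stateAt G ident Byz adv t u).self = ident u := by
  induction t with
  | zero => rfl
  | succ t ih => exact ih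

theorem counting_decision_succ (t : ℕ) (u : V) :
    ((counting γ α Δ).stateAt G ident Byz adv (t + 1) u).decision =
      ((counting γ α Δ).stateAt G ident Byz adv t u).decision.or
        (decideSize γ α Δ (t + 1) (ident u)
          ((counting γ α Δ).stateAt G ident Byz adv (t + 1) u).view) := by
  have hstep : ((counting γ α Δ).stateAt G ident Byz adv (t + 1) u).decision =
      ((counting γ α Δ).stateAt G ident Byz adv t u).decision.or
        (decideSize γ α Δ (((counting γ α Δ).stateAt G ident Byz adv t u).time + 1)
          ((counting γ α Δ).stateAt G ident Byz adv t u).self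
          ((counting γ α Δ).stateAt G ident Byz adv (t + 1) u).view) := rfl
  rw [hstep, counting_time, counting_self]

theorem counting_view_nil (t : ℕ) (u : V) (i : ℕ) :
    i ∈ ((counting γ α Δ).stateAt G ident Byz adv t u).view [] ↔
      ∃ v, G.Adj u v ∧ ident v = i := by
  induction t with
  | zero =>
    classical
    change i ∈ Finset.image ident _ ↔ _
    simp
  | succ t ih => exact ih

variable {ident}

theorem counting_view_cons (hid : Function.Injective ident) (t : ℕ) {u v : V} (huv : G.Adj u v)
    (hv : v ∉ Byz) (p : List ℕ) :
    ((counting γ α Δ).stateAt G ident Byz adv (t + 1) u).view (ident v :: p) =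
      ((counting γ α Δ).stateAt G ident Byz adv t v).view p := by
  classical
  have h := inbox_ident hid (fun v w => if v ∈ Byz then adv t v w
    else (counting γ α Δ).send ((counting γ α Δ).stateAt G ident Byz adv t v) (ident w)) huv
  rw [if_neg hv] at h
  exact congrArg (fun o : Option (List ℕ → Finset ℕ) => o.elim ∅ fun Q => Q p) h

/-- An honest neighbour forwards its own view of the previous round, so false messages only affect
paths through a Byzantine node. -/
theorem counting_faithful (hid : Function.Injective ident) (t : ℕ) (u : V) :
    G.Faithful Byz ident t ((counting γ α Δ).stateAt G ident Byz adv t u).view u := by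
  induction t generalizing u with
  | zero => exact counting_view_nil γ α Δ G ident Byz adv 0 u
  | succ t ih =>
    refine ⟨counting_view_nil γ α Δ G ident Byz adv (t + 1) u, fun v huv hv => ?_⟩
    simp only [counting_view_cons γ α Δ G Byz adv hid t huv hv]
    exact ih v

variable {α Δ G Byz} [DecidableEq V] [DecidableRel G.Adj]

theorem counting_decision (hα : 0 < α) (hΔ : 0 < Δ) (hid : Function.Injective ident)
    (hdeg : ∀ v, G.degree v ≤ Δ) (hexp : G.Expands α) {u : V} (hu : u ∈ G.reliable α Δ Byz) :
    ∃ m, ((counting γ α Δ).stateAt G ident Byz adv (escapeTime α Δ (Fintype.card V)) u).decision =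
        some (diamEstimate γ Δ m) ∧
      Fintype.card V ≤ 2 * m ∧ m ≤ 2 * Fintype.card V := by
  set n := Fintype.card V
  have htrue : ∀ t, Explains α Δ n t (ident u)
      ((counting γ α Δ).stateAt G ident Byz adv t u).view := fun t =>
    ⟨V, inferInstance, inferInstance, G, inferInstance, Byz, ident, u, rfl, hdeg, hexp, hid, hu,
      rfl, counting_faithful γ α Δ G Byz adv hid t u⟩
  have hcmp : ∀ t m, t ≤ escapeTime α Δ n → escapeTime α Δ m ≤ t →
      Explains α Δ m t (ident u) ((counting γ α Δ).stateAt G ident Byz adv t u).view →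
      n ≤ 2 * m ∧ m ≤ 2 * n := by
    intro t m htn hmt hm
    refine ⟨(htrue t).le_two_mul hα hΔ hm hmt, ?_⟩
    -- A premature decision is harmless: a size `m ≥ n` is only considered after its own escape
    -- time, by which time that of `n` has passed too.
    rcases le_total m n with hmn | hnm
    · omega
    · exact hm.le_two_mul hα hΔ (htrue t)
        ((escapeTime_mono α Δ (Fintype.card_pos_iff.2 ⟨u⟩) hnm).trans hmt)
  have hdecide : ∀ t L, t ≤ escapeTime α Δ n →
      decideSize γ α Δ t (ident u) ((counting γ α Δ).stateAt G ident Byz adv t u).view = some L →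
      ∃ m, some L = some (diamEstimate γ Δ m) ∧ n ≤ 2 * m ∧ m ≤ 2 * n := by
    intro t L ht hL
    rw [decideSize] at hL
    split_ifs at hL with h
    exact ⟨h.choose, hL.symm, hcmp t _ ht h.choose_spec.1 h.choose_spec.2⟩
  have hvalid : ∀ t, t ≤ escapeTime α Δ n → ∀ L,
      ((counting γ α Δ).stateAt G ident Byz adv t u).decision = some L →
      ∃ m, some L = some (diamEstimate γ Δ m) ∧ n ≤ 2 * m ∧ m ≤ 2 * n := by
    intro t
    induction t with
    | zero => intro _ L hL; cases hL
    | succ t ih =>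
      intro ht L hL
      rw [counting_decision_succ, Option.or_eq_some_iff] at hL
      rcases hL with hL | ⟨-, hL⟩
      · exact ih (by omega) L hL
      · exact hdecide (t + 1) L ht hL
  have hsome : ∃ L, ((counting γ α Δ).stateAt G ident Byz adv (escapeTime α Δ n) u).decision =
      some L := by
    refine Option.ne_none_iff_exists'.1 fun hnone => ?_
    -- The rule is not applied at time 0; the summand 1 in `escapeTime` ensures that it is applied
    -- at this time.
    have hsucc : escapeTime α Δ n = (escapeTime α Δ n - 1) + 1 := by simp [escapeTime]
    have hex : ∃ m, escapeTime α Δ m ≤ escapeTime α Δ n ∧ Explains α Δ m (escapeTime α Δ n)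
        (ident u) ((counting γ α Δ).stateAt G ident Byz adv (escapeTime α Δ n) u).view :=
      ⟨n, le_rfl, htrue _⟩
    rw [hsucc, counting_decision_succ, ← hsucc, Option.or_eq_none_iff, decideSize,
      dif_pos hex] at hnone
    exact Option.some_ne_none _ hnone.2
  obtain ⟨L, hL⟩ := hsome
  obtain ⟨m, hm, hmn⟩ := hvalid _ le_rfl L hL
  exact ⟨m, hL.trans hm, hmn⟩

end Counting

/-! ### Numerical estimates. -/

theorem log_four_mul_le {n : ℕ} (hn : 2 ≤ n) : Real.log (4 * n) ≤ 3 * Real.log n := by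
  have hn' : (2 : ℝ) ≤ n := by exact_mod_cast hn
  rw [← Real.log_rpow (by linarith)]
  refine Real.log_le_log (by linarith) ?_
  norm_cast
  nlinarith [Nat.mul_le_mul hn hn]

theorem one_le_two_mul_log {n : ℕ} (hn : 2 ≤ n) : 1 ≤ 2 * Real.log n := by
  have hn' : (2 : ℝ) ≤ n := by exact_mod_cast hn
  linarith [Real.log_le_log (by norm_num) hn', Real.log_two_gt_d9]

theorem escapeTime_le (α : ℝ) (Δ : ℕ) {n : ℕ} (hn : 2 ≤ n) :
    (escapeTime α Δ n : ℝ) ≤ (48 * Δ ^ 2 / α ^ 2 + 2) * Real.log n := by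
  have hn' : (2 : ℝ) ≤ n := by exact_mod_cast hn
  have hlog : 0 ≤ Real.log (4 * n) := Real.log_nonneg (by linarith)
  have h := Nat.floor_le (by positivity : 0 ≤ 16 * (Δ : ℝ) ^ 2 / α ^ 2 * Real.log (4 * n))
  have h' := mul_le_mul_of_nonneg_left (log_four_mul_le hn)
    (by positivity : 0 ≤ 16 * (Δ : ℝ) ^ 2 / α ^ 2)
  have h1 := one_le_two_mul_log hn
  rw [escapeTime]
  push_cast
  calc (⌊16 * (Δ : ℝ) ^ 2 / α ^ 2 * Real.log (4 * n)⌋₊ : ℝ) + 1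
      ≤ 16 * (Δ : ℝ) ^ 2 / α ^ 2 * (3 * Real.log n) + 2 * Real.log n := by linarith
    _ = _ := by ring

theorem isLittleO_escapeTime_mul_rpow {γ : ℝ} (hγ : 0 < γ) (α : ℝ) (Δ : ℕ) :
    (fun n : ℕ => 4 * (((escapeTime α Δ n : ℝ) + 1) * (n : ℝ) ^ (1 - γ))) =o[atTop]
      fun n : ℕ => (n : ℝ) := by
  have hlog : (fun n : ℕ => (escapeTime α Δ n : ℝ) + 1) =O[atTop] fun n : ℕ => Real.log n := by
    refine IsBigO.of_bound (48 * Δ ^ 2 / α ^ 2 + 2 + 2) ?_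
    filter_upwards [eventually_ge_atTop 2] with n hn
    have h1 := one_le_two_mul_log hn
    rw [Real.norm_of_nonneg (by positivity), Real.norm_of_nonneg (by linarith)]
    linarith [escapeTime_le α Δ hn]
  have hlog' : (fun n : ℕ => Real.log n) =o[atTop] fun n : ℕ => (n : ℝ) ^ γ :=
    (isLittleO_log_rpow_atTop hγ).comp_tendsto tendsto_natCast_atTop_atTop
  have h := ((hlog.trans_isLittleO hlog').mul_isBigO
    (isBigO_refl (fun n : ℕ => (n : ℝ) ^ (1 - γ)) atTop)).const_mul_left 4
  refine h.congr' EventuallyEq.rfl ?_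
  filter_upwards [eventually_gt_atTop 0] with n hn
  rw [← Real.rpow_add (by exact_mod_cast hn)]
  simp

theorem le_diamEstimate {γ : ℝ} (hγ : 0 < γ) (Δ : ℕ) {m n : ℕ} (hn : 0 < n) (h : n ≤ 2 * m) :
    γ / 2 * Real.logb Δ n ≤ diamEstimate γ Δ m := by
  refine le_trans ?_ (Nat.le_ceil _)
  have h' : (n : ℝ) ≤ 2 * m := by exact_mod_cast h
  have hn' : (0 : ℝ) < n := by exact_mod_cast hn
  have hlog := Real.log_le_log hn' h'
  rw [Real.logb, Real.logb]
  have := Real.log_natCast_nonneg Δ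
  gcongr

theorem diamEstimate_le {γ : ℝ} (hγ0 : 0 < γ) (hγ1 : γ < 1) (Δ : ℕ) {m n : ℕ} (hm : 0 < m)
    (hn : 2 ≤ n) (h : m ≤ 2 * n) : (diamEstimate γ Δ m : ℝ) ≤ 5 * Real.log n := by
  have hm' : (1 : ℝ) ≤ m := by exact_mod_cast hm
  have h' : (m : ℝ) ≤ 2 * n := by exact_mod_cast h
  have hlm : 0 ≤ Real.log (2 * m) := Real.log_nonneg (by linarith)
  have hlog : Real.log (2 * m) ≤ 3 * Real.log n :=
    (Real.log_le_log (by linarith) (by linarith)).trans (log_four_mul_le hn)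
  have hb : Real.logb Δ (2 * m) ≤ 2 * Real.log (2 * m) := by
    rw [Real.logb]
    rcases Nat.lt_or_ge Δ 2 with hΔ | hΔ
    · have : Real.log Δ = 0 := by interval_cases Δ <;> simp
      rw [this, div_zero]
      linarith
    · have h2 := one_le_two_mul_log hΔ
      rw [div_le_iff₀ (by linarith)]
      nlinarith
  have hb0 : 0 ≤ Real.logb Δ (2 * m) := div_nonneg hlm (Real.log_natCast_nonneg Δ)
  have hceil := (Nat.ceil_lt_add_one (by positivity : 0 ≤ γ / 2 * Real.logb Δ (2 * m))).le
  have h1 := one_le_two_mul_log hn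
  rw [diamEstimate]
  nlinarith

/-- Since γ/2 < 1/2, it suffices that 2m ≤ 4n ≤ Δ^(2d). The threshold on `n` forces d ≥ 5, which
absorbs both the factor 4 and the gap between Δ + 1 and Δ. -/
theorem diamEstimate_le_diam {γ : ℝ} (hγ0 : 0 < γ) (hγ1 : γ < 1) {Δ d m n : ℕ} (hm : 0 < m)
    (h : m ≤ 2 * n) (hlow : (Δ + 1) ^ 4 < n) (hd : n ≤ (Δ + 1) ^ d) : diamEstimate γ Δ m ≤ d := by
  rw [diamEstimate, Nat.ceil_le]
  have hm' : (1 : ℝ) ≤ m := by exact_mod_cast hm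
  rcases Nat.lt_or_ge Δ 2 with hΔ | hΔ
  -- For Δ ≤ 1, division by log Δ = 0 makes the estimate 0.
  · have : Real.log Δ = 0 := by interval_cases Δ <;> simp
    rw [Real.logb, this, div_zero, mul_zero]
    positivity
  · have hΔ' : (2 : ℝ) ≤ Δ := by exact_mod_cast hΔ
    have h5 : 5 ≤ d := by
      by_contra! hlt
      exact absurd (hd.trans (Nat.pow_le_pow_right (by omega) (by omega : d ≤ 4))) (by omega)
    have h' : (m : ℝ) ≤ 2 * n := by exact_mod_cast h
    have hd' : (n : ℝ) ≤ (Δ + 1) ^ d := by exact_mod_cast hd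
    -- The base 4/3 is the largest with (4/3)(Δ + 1) ≤ Δ² for all Δ ≥ 2 (equality at Δ = 2), and its
    -- fifth power exceeds 4.
    have h43 : (4 : ℝ) ≤ (4 / 3) ^ d :=
      le_trans (by norm_num) (pow_le_pow_right₀ (by norm_num) h5 : (4 / 3 : ℝ) ^ 5 ≤ (4 / 3) ^ d)
    have hpow : (2 * m : ℝ) ≤ Δ ^ (2 * d) := by
      calc (2 * m : ℝ) ≤ 4 * (Δ + 1) ^ d := by linarith
        _ ≤ (4 / 3) ^ d * (Δ + 1) ^ d := by gcongr
        _ = (4 / 3 * (Δ + 1)) ^ d := (mul_pow _ _ _).symm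
        _ ≤ (Δ ^ 2) ^ d := by gcongr; nlinarith
        _ = Δ ^ (2 * d) := (pow_mul _ _ _).symm
    have hlogb : Real.logb Δ (2 * m) ≤ 2 * d := by
      rw [Real.logb_le_iff_le_rpow (by linarith) (by linarith)]
      exact_mod_cast hpow
    have hb0 : 0 ≤ Real.logb Δ (2 * m) := Real.logb_nonneg (by linarith) (by linarith)
    nlinarith

end LocalAlgorithm

/-! ### Assembling the theorem. -/

open LocalAlgorithm

theorem theorem4p1 (γ : ℝ) (hγ0 : 0 < γ) (hγ1 : γ < 1) (Δ : ℕ) (hΔ : 0 < Δ)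
    (α : ℝ) (hα : 0 < α) :
    ∃ (A : LocalAlgorithm) (C : ℝ) (f : ℕ → ℝ),
      f =o[atTop] (fun n : ℕ => (n : ℝ)) ∧
      ∀ (V : Type) [Fintype V] [DecidableEq V] (G : SimpleGraph V) [DecidableRel G.Adj]
        (n : ℕ) (Byz : Finset V),
        Fintype.card V = n →
        (∀ v : V, G.degree v ≤ Δ) →
        α ≤ G.vertexExpansion →
        (Byz.card : ℝ) ≤ (n : ℝ) ^ (1 - γ) →
        ∃ Good : Finset V,
          Disjoint Good Byz ∧
          (n : ℝ) - f n ≤ (Good.card : ℝ) ∧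
          ∀ (ident : V → ℕ), Function.Injective ident →
          ∀ (adv : ℕ → V → V → Option A.Msg), ∀ u ∈ Good,
            ∃ t L : ℕ,
              (t : ℝ) ≤ C * Real.log n ∧
              A.output (A.stateAt G ident Byz adv t u) = some L ∧
              γ / (2 * Real.log Δ) * Real.log n ≤ (L : ℝ) ∧
              (L : ℝ) ≤ C * Real.log n ∧
              ⌊γ / 2 * Real.logb Δ n⌋₊ ≤ L ∧
              L ≤ G.diam + 1 := by
  -- Below the threshold f(n) = n permits an empty good set. In the constant, the first term plus 2
  -- bounds the running time and 5 bounds the decided value.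
  refine ⟨counting γ α Δ, 48 * Δ ^ 2 / α ^ 2 + 5,
    fun n => if (Δ + 1) ^ 4 < n then
      4 * (((escapeTime α Δ n : ℝ) + 1) * (n : ℝ) ^ (1 - γ)) else n, ?_, ?_⟩
  · refine (isLittleO_escapeTime_mul_rpow hγ0 α Δ).congr' ?_ EventuallyEq.rfl
    filter_upwards [eventually_gt_atTop ((Δ + 1) ^ 4)] with n hn
    rw [if_pos hn]
  intro V _ _ G _ n Byz hcard hdeg hexp hByz
  by_cases hn : (Δ + 1) ^ 4 < n
  swap
  · exact ⟨∅, Finset.disjoint_empty_left _, by simp [hn], by simp⟩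
  have hexp' := expands_of_le_vertexExpansion hexp
  refine ⟨G.reliable α Δ Byz, disjoint_reliable G α Δ Byz, ?_, ?_⟩
  · have h := le_card_reliable α hΔ hdeg Byz
    rw [hcard] at h
    simp only [if_pos hn]
    refine le_trans ?_ h
    gcongr
  intro ident hid adv u hu
  obtain ⟨m, hdec, hnm, hmn⟩ := counting_decision γ adv hα hΔ hid hdeg hexp' hu
  rw [hcard] at hdec hnm hmn
  have hn2 : 2 ≤ n := by
    have := Nat.one_le_pow 4 (Δ + 1) (by omega)
    omega
  have hm0 : 0 < m := by omega
  have hlog : 0 ≤ Real.log n := Real.log_natCast_nonneg n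
  have hlow := le_diamEstimate hγ0 Δ (by omega : 0 < n) hnm
  have : Nonempty V := ⟨u⟩
  have hdiam := card_le_pow_diam (hexp'.connected hα) hdeg
  rw [hcard] at hdiam
  refine ⟨escapeTime α Δ n, diamEstimate γ Δ m, ?_, hdec, ?_, ?_, ?_, ?_⟩
  · refine (escapeTime_le α Δ hn2).trans (mul_le_mul_of_nonneg_right (by linarith) hlog)
  · refine le_trans (le_of_eq ?_) hlow
    rw [Real.logb, mul_comm 2 (Real.log Δ), ← div_div]
    ring
  · refine (diamEstimate_le hγ0 hγ1 Δ hm0 hn2 hmn).trans (mul_le_mul_of_nonneg_right ?_ hlog)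
    have : 0 ≤ 48 * (Δ : ℝ) ^ 2 / α ^ 2 := by positivity
    linarith
  · exact Nat.floor_le_of_le hlow
  · exact (diamEstimate_le_diam hγ0 hγ1 hm0 hmn hn hdiam).trans (Nat.le_succ _)
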